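/- Let $q\in\mathbb{C}^{\times}$ be of infinite order (i.e. not a root of unity). Let $U=U_q(L\mathfrak{sl}_2)$ be the quantum loop algebra in the loop presentation: the unital associative $\mathbb{C}$-algebra with generators $E_k,F_k$ ($k\in\mathbb{Z}$) and $\psi^{\pm}_{\pm\ell}$ ($\ell\ge 0$), with the convention $\psi^{\pm}_{\mp r}=0$ for $r\geq 1$, and the following relations. * All $\psi^{+}_r,\psi^-_s$ commute with each other, and $\psi^+_0\psi^-_0=1$. Write $K=\psi^+_0$, so $K^{-1}=\psi^-_0$. * $K^{\pm1}E_kK^{\mp1}=q^{\pm2}E_k$ and $K^{\pm1}F_kK^{\mp1}=q^{\mp2}F_k$ for $k\in\mathbb{Z}$. * For $\eta\in\{\pm\}$, $l\in\mathbb{Z}$, and $k\ge 0$ if $\eta=+$, $k<0$ if $\eta=-$: $$\psi^\eta_{k+1}E_l-q^2E_l\psi^\eta_{k+1}=q^2\psi^\eta_kE_{l+1}-E_{l+1}\psi^\eta_k,\qquad \psi^\eta_{k+1}F_l-q^{-2}F_l\psi^\eta_{k+1}=q^{-2}\psi^\eta_kF_{l+1}-F_{l+1}\psi^\eta_k.$$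 * For $k,l\in\mathbb{Z}$: $$E_{k+1}E_l-q^2E_lE_{k+1}=q^2E_kE_{l+1}-E_{l+1}E_k,\qquad F_{k+1}F_l-q^{-2}F_lF_{k+1}=q^{-2}F_kF_{l+1}-F_{l+1}F_k.$$ * For $k,l\in\mathbb{Z}$: $\displaystyle [E_k,F_l]=\frac{\psi^+_{k+l}-\psi^-_{k+l}}{q-q^{-1}}$. Let $E^+(z)=\sum_{n\ge0}E_nz^{-n}$ and $\psi^+(z)=\sum_{n\ge 0}\psi^+_nz^{-n}$, and let $\mathcal{P}^+(z)\in U[\![z^{-1}]\!]$ be the Chari–Pressley series, i.e. the unique solution of $$\mathcal{P}^+(q^2z)=K^{-1}\psi^+(z)\,\mathcal{P}^+(z),\qquad \mathcal{P}^+(\infty)=1.$$ Put $[n]=\frac{q^n-q^{-n}}{q-q^{-1}}$, $[n]!=[n][n-1]\cdots[1]$ and $x^{(n)}=x^n/[n]!$. Then the following identity holds in $U[\![z^{-1}]\!]$: $$\sum_{n=0}^{\infty}(-1)^nq^{n^2}E_0^{(n)}F_1^{(n)}K^{-n}z^{-n}=\sum_{\ell=0}^{\infty}(-1)^\ell q^{\ell^2}K^{-\ell}z^{-\ell}\,\mathcal{P}^+(q^{-2\ell}z)\left(F_1-q^{2\ell+2}F_2z^{-1}\right)^{(\ell)}E^+(q^{-2\ell}z)^{(\ell)},$$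 where the sum on the right converges in the formal ($z^{-1}$-adic) sense. -/

import Mathlib

open scoped PowerSeries PowerSeries.WithPiTopology

noncomputable section

namespace QLoop

/-- Generators of the loop presentation of `U_q(L sl_2)`: `E k` and `F k` for `k : ℤ`, and
`psi η l`, which stands for `ψ^η_{η l}` with a sign `η = ±1` and `l ≥ 0`. -/
inductive Gen : Type
  | E (k : ℤ)
  | F (k : ℤ)
  | psi (η : ℤˣ) (l : ℕ)

namespace Free

/-- `E_k` in the free algebra. -/
def E (k : ℤ) : FreeAlgebra ℂ Gen := FreeAlgebra.ι ℂ (Gen.E k)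

/-- `F_k` in the free algebra. -/
def F (k : ℤ) : FreeAlgebra ℂ Gen := FreeAlgebra.ι ℂ (Gen.F k)

/-- `ψ^η_k` in the free algebra for every integer `k`, with the convention that it is zero when
`η k < 0`. -/
def psi (η : ℤˣ) (k : ℤ) : FreeAlgebra ℂ Gen :=
  if 0 ≤ (η : ℤ) * k then FreeAlgebra.ι ℂ (Gen.psi η k.natAbs) else 0

end Free

open Free in
/-- The defining relations of `U_q(L sl_2)` in the loop presentation (the Cartan matrix is `(2)`,
so that there are no Serre relations). -/
inductive Rel (q : ℂ) : FreeAlgebra ℂ Gen → FreeAlgebra ℂ Gen → Prop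
  | psi_comm (η θ : ℤˣ) (r s : ℤ) : Rel q (psi η r * psi θ s) (psi θ s * psi η r)
  | psi_inv : Rel q (psi 1 0 * psi (-1) 0) 1
  | weight_E (η : ℤˣ) (k : ℤ) :
      Rel q (psi η 0 * E k * psi (-η) 0) (q ^ (2 * (η : ℤ)) • E k)
  | weight_F (η : ℤˣ) (k : ℤ) :
      Rel q (psi η 0 * F k * psi (-η) 0) (q ^ (-2 * (η : ℤ)) • F k)
  | psi_E (η : ℤˣ) (k l : ℤ) (hk : (η = 1 ∧ 0 ≤ k) ∨ (η = -1 ∧ k < 0)) :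
      Rel q (psi η (k + 1) * E l - q ^ (2 : ℤ) • (E l * psi η (k + 1)))
        (q ^ (2 : ℤ) • (psi η k * E (l + 1)) - E (l + 1) * psi η k)
  | psi_F (η : ℤˣ) (k l : ℤ) (hk : (η = 1 ∧ 0 ≤ k) ∨ (η = -1 ∧ k < 0)) :
      Rel q (psi η (k + 1) * F l - q ^ (-2 : ℤ) • (F l * psi η (k + 1)))
        (q ^ (-2 : ℤ) • (psi η k * F (l + 1)) - F (l + 1) * psi η k)
  | E_E (k l : ℤ) :
      Rel q (E (k + 1) * E l - q ^ (2 : ℤ) • (E l * E (k + 1)))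
        (q ^ (2 : ℤ) • (E k * E (l + 1)) - E (l + 1) * E k)
  | F_F (k l : ℤ) :
      Rel q (F (k + 1) * F l - q ^ (-2 : ℤ) • (F l * F (k + 1)))
        (q ^ (-2 : ℤ) • (F k * F (l + 1)) - F (l + 1) * F k)
  | E_F (k l : ℤ) :
      Rel q (E k * F l - F l * E k) ((q - q⁻¹)⁻¹ • (psi 1 (k + l) - psi (-1) (k + l)))

/-- The quantum loop algebra `U_q(L sl_2)`: the unital associative `ℂ`-algebra given by the
generators `Gen` and the relations `Rel q`. -/
def U (q : ℂ) : Type := RingQuot (Rel q)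

instance (q : ℂ) : Ring (U q) := inferInstanceAs (Ring (RingQuot (Rel q)))

instance (q : ℂ) : Algebra ℂ (U q) := inferInstanceAs (Algebra ℂ (RingQuot (Rel q)))

/-- `U q` carries the discrete topology, so that the (scoped) product topology on `(U q)⟦X⟧` is
the topology of formal power series: a family is summable exactly if each coefficient is a
sum with finitely many nonzero terms. -/
instance (q : ℂ) : TopologicalSpace (U q) := ⊥

instance (q : ℂ) : DiscreteTopology (U q) := ⟨rfl⟩

/-- The quotient map from the free algebra. -/
def mkU (q : ℂ) : FreeAlgebra ℂ Gen →ₐ[ℂ] U q := RingQuot.mkAlgHom ℂ (Rel q)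

theorem mkU_rel {q : ℂ} {a b : FreeAlgebra ℂ Gen} (h : Rel q a b) : mkU q a = mkU q b :=
  RingQuot.mkAlgHom_rel ℂ h

/-- The element `E_k` of `U_q(L sl_2)`. -/
def E (q : ℂ) (k : ℤ) : U q := mkU q (Free.E k)

/-- The element `F_k` of `U_q(L sl_2)`. -/
def F (q : ℂ) (k : ℤ) : U q := mkU q (Free.F k)

/-- The element `ψ^η_k` of `U_q(L sl_2)`, zero when `η k < 0`. -/
def psi (q : ℂ) (η : ℤˣ) (k : ℤ) : U q := mkU q (Free.psi η k)

theorem psi_mul_psi_neg (q : ℂ) : psi q 1 0 * psi q (-1) 0 = 1 := by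
  simpa [psi] using mkU_rel (Rel.psi_inv (q := q))

theorem psi_neg_mul_psi (q : ℂ) : psi q (-1) 0 * psi q 1 0 = 1 := by
  have h := mkU_rel (Rel.psi_comm (q := q) (-1) 1 0 0)
  simp only [map_mul] at h
  exact h.trans (psi_mul_psi_neg q)

/-- The invertible element `K = ψ^+_0`, whose inverse is `ψ^-_0`. -/
def K (q : ℂ) : (U q)ˣ where
  val := psi q 1 0
  inv := psi q (-1) 0
  val_inv := psi_mul_psi_neg q
  inv_val := psi_neg_mul_psi q

/-! Formal power series in `z⁻¹` are elements of `(U q)⟦X⟧`, where the (central) variable `X`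
stands for `z⁻¹`. -/

/-- The series `f(c z)`, for a series `f(z) = ∑ f_n z^{-n}` and a scalar `c`. -/
def dilate {q : ℂ} (c : ℂ) (f : (U q)⟦X⟧) : (U q)⟦X⟧ :=
  PowerSeries.mk fun n => c ^ (-(n : ℤ)) • PowerSeries.coeff n f

/-- The half-current `E^+(z) = ∑_{n ≥ 0} E_n z^{-n}`. -/
def EPlus (q : ℂ) : (U q)⟦X⟧ := PowerSeries.mk fun n => E q n

/-- The normalised series `K⁻¹ ψ^+(z) = ∑_{n ≥ 0} K⁻¹ ψ^+_n z^{-n}`. -/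
def psiBar (q : ℂ) : (U q)⟦X⟧ := PowerSeries.mk fun n => (↑(K q)⁻¹ : U q) * psi q 1 n

/-- The coefficients of the Chari-Pressley series. -/
def cpCoeff (q : ℂ) : ℕ → U q
  | 0 => 1
  | n + 1 => (q ^ (-(2 * (n + 1 : ℤ))) - 1)⁻¹ •
      ∑ k : Fin (n + 1), PowerSeries.coeff (n + 1 - (k : ℕ)) (psiBar q) * cpCoeff q k

/-- The Chari-Pressley series `P^+(z)`. For `q` nonzero and of infinite order it is the unique
solution of `P^+(q² z) = K⁻¹ ψ^+(z) P^+(z)` with `P^+(∞) = 1`, see `eq_cpSeries_iff`. -/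
def cpSeries (q : ℂ) : (U q)⟦X⟧ := PowerSeries.mk (cpCoeff q)

theorem coeff_zero_psiBar (q : ℂ) : PowerSeries.coeff 0 (psiBar q) = 1 := by
  have : psi q 1 0 = (K q : U q) := rfl
  simp [psiBar, this]

theorem coeff_psiBar_mul (q : ℂ) (P : (U q)⟦X⟧) (n : ℕ) :
    PowerSeries.coeff (n + 1) (psiBar q * P) = PowerSeries.coeff (n + 1) P +
      ∑ k : Fin (n + 1), PowerSeries.coeff (n + 1 - (k : ℕ)) (psiBar q) *
        PowerSeries.coeff (k : ℕ) P := by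
  rw [PowerSeries.coeff_mul, Finset.Nat.sum_antidiagonal_eq_sum_range_succ_mk,
    ← Finset.sum_range_reflect, Finset.sum_range_succ, add_comm]
  congr 1
  · simp [coeff_zero_psiBar]
  · rw [Finset.sum_range]
    refine Finset.sum_congr rfl fun k _ => ?_
    have hk := k.2
    congr 3
    omega

/-- The Chari-Pressley series is the unique solution of its `q`-difference equation that takes
the value `1` at `z = ∞`. -/
theorem eq_cpSeries_iff {q : ℂ} (hq : ∀ n : ℕ, 0 < n → q ^ n ≠ 1)
    (P : (U q)⟦X⟧) :
    P = cpSeries q ↔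
      PowerSeries.constantCoeff P = 1 ∧ dilate (q ^ 2) P = psiBar q * P := by
  have hne : ∀ n : ℕ, q ^ (-(2 * (n + 1 : ℤ))) - 1 ≠ 0 := by
    intro n h
    refine hq (2 * (n + 1)) (by omega) ?_
    rw [sub_eq_zero, zpow_neg, inv_eq_one] at h
    exact_mod_cast h
  have hpow : ∀ n : ℕ, (q ^ 2) ^ (-((n + 1 : ℕ) : ℤ)) = q ^ (-(2 * (n + 1 : ℤ))) := by
    intro n
    rw [← zpow_natCast q 2, ← zpow_mul]
    congr 1
  have key : ∀ (R : (U q)⟦X⟧) (n : ℕ),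
      PowerSeries.coeff (n + 1) (dilate (q ^ 2) R) = PowerSeries.coeff (n + 1) (psiBar q * R) ↔
      PowerSeries.coeff (n + 1) R = (q ^ (-(2 * (n + 1 : ℤ))) - 1)⁻¹ •
        ∑ k : Fin (n + 1), PowerSeries.coeff (n + 1 - (k : ℕ)) (psiBar q) *
          PowerSeries.coeff (k : ℕ) R := by
    intro R n
    rw [coeff_psiBar_mul, dilate, PowerSeries.coeff_mk, hpow, eq_inv_smul_iff₀ (hne n), sub_smul,
      one_smul, sub_eq_iff_eq_add']
  constructor
  · rintro rfl
    refine ⟨by simp [cpSeries, ← PowerSeries.coeff_zero_eq_constantCoeff_apply, cpCoeff], ?_⟩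
    ext n
    cases n with
    | zero =>
      simp [PowerSeries.coeff_mul, coeff_zero_psiBar, dilate]
    | succ n =>
      rw [key]
      simp only [cpSeries, PowerSeries.coeff_mk]
      rw [cpCoeff]
  · rintro ⟨h0, h⟩
    have hc : ∀ n, PowerSeries.coeff n P = cpCoeff q n := by
      intro n
      induction n using Nat.strong_induction_on with
      | _ n ih =>
        cases n with
        | zero => simpa [cpCoeff] using h0
        | succ n =>
          rw [(key P n).1 (by rw [h]), cpCoeff]
          congr 1
          exact Finset.sum_congr rfl fun k _ => by rw [ih k k.2]
    ext n
    rw [hc, cpSeries, PowerSeries.coeff_mk]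

/-- The Gaussian integer `[n] = (q^n - q^{-n}) / (q - q^{-1})`. -/
def qInt (q : ℂ) (n : ℕ) : ℂ := (q ^ n - (q ^ n)⁻¹) / (q - q⁻¹)

/-- `[n]! = [n] [n-1] ⋯ [1]`. -/
def qFactorial (q : ℂ) (n : ℕ) : ℂ := ∏ k ∈ Finset.range n, qInt q (k + 1)

/-- The divided power `x^{(n)} = x^n / [n]!`. -/
def divPow {A : Type*} [Ring A] [Algebra ℂ A] (q : ℂ) (x : A) (n : ℕ) : A :=
  (qFactorial q n)⁻¹ • x ^ n

end QLoop

end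

noncomputable section

namespace QLoop

/-! ### Power series over a noncommutative algebra: rescaling and multiplication by the variable -/

section Generic

variable {A : Type*} [Ring A] [Algebra ℂ A]

/-! Put X = z⁻¹ and F⁺(z) = ∑ F_{n+1} Xⁿ. The coefficient of z⁻ⁿ on the left is, up to a scalar and
K⁻ⁿ, the product E_0^{(n)} F_1^{(n)}. `divPow_E_mul_divPow_F` normally orders E_0^{(r)} F_1^{(s)}
for r ≤ s: it is a combination of the Xᵗ-coefficients of F⁺(z)^{(s-t)} P⁺(z) E⁺(z)^{(r-t)}, times
Kᵗ. For r = s = n and l = n - t these are the terms on the right, since F⁺ P⁺ = P⁺ (F_1 - q² F_2 X)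
(`FPlus_mul_cpSeries`) and z is rescaled to q⁻²ˡ z.

Normal ordering is an induction on r, multiplying by E_0 on the left. Crossing a power of F⁺, E_0
leaves a Cartan series in every position. A current a(z) and its rescaling b by p = q^{±2} satisfy
(1 + p) b a = a² + p b² (`current_mul_scaleX_current`), which collapses the sum over positions to
one product; the q-difference equation then absorbs the Cartan series into P⁺. Crossing P⁺ and a
power of E⁺, E_0 yields a difference of powers of E⁺(z) and E⁺(q⁻²z). The terms with E⁺(q⁻²z) from
the two sources cancel, and the others add up to the factor [r+1] needed for divided powers.

The identities for currents come from two uniqueness principles, `eq_zero_of_eq_smul_mulX` and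
`eq_zero_of_scaleX_eq`: the defect of an identity, taken for all indices l at once, satisfies a
homogeneous recursion. -/

@[simp]
theorem coeff_complex_smul (n : ℕ) (c : ℂ) (f : A⟦X⟧) :
    PowerSeries.coeff n (c • f) = c • PowerSeries.coeff n f := rfl

theorem C_complex_smul (c : ℂ) (a : A) : PowerSeries.C (c • a) = c • PowerSeries.C a := by
  ext n
  by_cases hn : n = 0 <;> simp [PowerSeries.coeff_C, hn]

/-- The substitution `f(X) ↦ f(c X)` of formal power series. -/
def scaleX (c : ℂ) : A⟦X⟧ →ₐ[ℂ] A⟦X⟧ :=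
  AlgHom.ofLinearMap
    { toFun := fun f => PowerSeries.mk fun n => c ^ n • PowerSeries.coeff n f
      map_add' := fun f g => by ext n; simp
      map_smul' := fun a f => by
        ext n
        simp only [PowerSeries.coeff_mk, RingHom.id_apply, coeff_complex_smul]
        rw [smul_comm] }
    (by
      ext n
      by_cases hn : n = 0
      · simp [hn]
      · simp [PowerSeries.coeff_one, hn])
    (fun f g => by
      ext n
      simp only [LinearMap.coe_mk, AddHom.coe_mk, PowerSeries.coeff_mk, PowerSeries.coeff_mul,
        Finset.smul_sum]
      refine Finset.sum_congr rfl fun ij hij => ?_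
      rw [smul_mul_smul_comm, ← pow_add, Finset.HasAntidiagonal.mem_antidiagonal.1 hij])

@[simp]
theorem coeff_scaleX (c : ℂ) (f : A⟦X⟧) (n : ℕ) :
    PowerSeries.coeff n (scaleX c f) = c ^ n • PowerSeries.coeff n f := by
  simp [scaleX]

@[simp]
theorem constantCoeff_scaleX (c : ℂ) (f : A⟦X⟧) :
    PowerSeries.constantCoeff (scaleX c f) = PowerSeries.constantCoeff f := by
  rw [← PowerSeries.coeff_zero_eq_constantCoeff_apply, coeff_scaleX, pow_zero, one_smul,
    PowerSeries.coeff_zero_eq_constantCoeff_apply]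

@[simp]
theorem scaleX_C (c : ℂ) (a : A) : scaleX c (PowerSeries.C a) = PowerSeries.C a := by
  ext n
  by_cases hn : n = 0 <;> simp [PowerSeries.coeff_C, hn]

@[simp]
theorem scaleX_scaleX (c d : ℂ) (f : A⟦X⟧) : scaleX c (scaleX d f) = scaleX (c * d) f := by
  ext n
  simp [smul_smul, mul_pow]

@[simp]
theorem scaleX_one (f : A⟦X⟧) : scaleX 1 f = f := by
  ext n
  simp

/-- Multiplication of formal power series by the variable, as a linear map. -/
def mulX : A⟦X⟧ →ₗ[ℂ] A⟦X⟧ := LinearMap.mulLeft ℂ PowerSeries.X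

theorem mulX_apply (f : A⟦X⟧) : mulX f = PowerSeries.X * f := rfl

@[simp]
theorem constantCoeff_mulX (f : A⟦X⟧) : PowerSeries.constantCoeff (mulX f) = 0 := by
  simp [mulX_apply]

@[simp]
theorem coeff_succ_mulX (f : A⟦X⟧) (n : ℕ) :
    PowerSeries.coeff (n + 1) (mulX f) = PowerSeries.coeff n f := by
  simp [mulX_apply, PowerSeries.coeff_succ_X_mul]

theorem mulX_mul (f g : A⟦X⟧) : mulX f * g = mulX (f * g) := by
  simp [mulX_apply, mul_assoc]

theorem mul_mulX (f g : A⟦X⟧) : f * mulX g = mulX (f * g) := by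
  rw [mulX_apply, mulX_apply, ← mul_assoc, (PowerSeries.commute_X f).eq, mul_assoc]

theorem scaleX_mulX (c : ℂ) (f : A⟦X⟧) : scaleX c (mulX f) = c • mulX (scaleX c f) := by
  ext n
  cases n <;> simp [pow_succ', smul_smul]

/-! ### Half-currents and two uniqueness principles -/

/-- The half-current `∑_{n ≥ 0} y_{l+n} X^n`. -/
def current (y : ℤ → A) (l : ℤ) : A⟦X⟧ := PowerSeries.mk fun n => y (l + n)

theorem current_eq (y : ℤ → A) (l : ℤ) :
    current y l = PowerSeries.C (y l) + mulX (current y (l + 1)) := by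
  ext n
  cases n with
  | zero => simp [current]
  | succ n =>
    simp only [current, PowerSeries.coeff_mk, map_add, coeff_succ_mulX, PowerSeries.coeff_C]
    simp [add_comm, add_left_comm]

theorem scaleX_current_eq (c : ℂ) (y : ℤ → A) (l : ℤ) :
    scaleX c (current y l) = PowerSeries.C (y l) + c • mulX (scaleX c (current y (l + 1))) := by
  conv_lhs => rw [current_eq]
  rw [map_add, scaleX_C, scaleX_mulX]

/-- Iterating the hypothesis makes every `f l` divisible by all powers of X. Subtracting the
shifted, X-multiplied copy reduces a half-current to its leading generator, so identities of
currents reduce to the defining relations. -/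
theorem eq_zero_of_eq_smul_mulX {f : ℤ → A⟦X⟧} {c : ℂ}
    (h : ∀ l, f l = c • mulX (f (l + 1))) (l : ℤ) : f l = 0 := by
  ext n
  induction n generalizing l with
  | zero => rw [h]; simp
  | succ n ih => rw [h]; simp only [coeff_complex_smul, coeff_succ_mulX, ih]; simp

/-- In degree n + 1 the shifted terms and the higher coefficients of `g` only meet coefficients of
`f` of lower degree, which vanish by induction for all l. What remains is multiplied by c^(n+1) - 1
≠ 0. -/
theorem eq_zero_of_scaleX_eq {f : ℤ → A⟦X⟧} {g : A⟦X⟧} {c a b : ℂ}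
    (hc : ∀ n : ℕ, 0 < n → c ^ n ≠ 1) (hg : PowerSeries.coeff 0 g = 1)
    (h0 : ∀ l, PowerSeries.coeff 0 (f l) = 0)
    (h : ∀ l, scaleX c (f l) - a • mulX (scaleX c (f (l + 1))) =
      g * (f l - b • mulX (f (l + 1)))) (l : ℤ) : f l = 0 := by
  ext n
  induction n using Nat.strong_induction_on generalizing l with
  | _ n ih =>
    cases n with
    | zero => simpa using h0 l
    | succ n =>
      have key := congrArg (PowerSeries.coeff (n + 1)) (h l)
      have hlow : ∀ m l, m < n + 1 → PowerSeries.coeff m (f l) = 0 := fun m l hm => by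
        simpa using ih m hm l
      have hs : ∀ m, m ≤ n + 1 → PowerSeries.coeff m (f l - b • mulX (f (l + 1))) =
          PowerSeries.coeff m (f l) := by
        intro m hm
        cases m with
        | zero => simp
        | succ m => simp [hlow m (l + 1) (by omega)]
      rw [PowerSeries.coeff_mul, Finset.sum_eq_single (0, n + 1), hs _ le_rfl, hg, one_mul] at key
      · simp only [map_sub, coeff_scaleX, coeff_complex_smul, coeff_succ_mulX,
          hlow n (l + 1) (by omega), smul_zero, sub_zero] at key
        have h1 : (c ^ (n + 1) - 1) • PowerSeries.coeff (n + 1) (f l) = 0 := by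
          rw [sub_smul, one_smul, key, sub_self]
        simpa using (smul_eq_zero_iff_right (sub_ne_zero.2 (hc _ n.succ_pos))).1 h1
      · rintro ⟨i, j⟩ hij hne
        rw [Finset.HasAntidiagonal.mem_antidiagonal] at hij
        have hj : j < n + 1 := by
          rcases Nat.eq_zero_or_pos i with hi | hi
          · exact absurd (by ext <;> simp_all) hne
          · simp only at hij; omega
        rw [hs _ hj.le, hlow j l hj, mul_zero]
      · simp

theorem smul_right_injective_of_ne {c : ℂ} (hc : c ≠ 0) {M : Type*} [AddCommGroup M] [Module ℂ M]
    {x y : M} (h : c • x = c • y) : x = y := by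
  simpa [smul_smul, inv_mul_cancel₀ hc] using congrArg (c⁻¹ • ·) h

/-! ### Quadratic relations of half-currents -/

/-- The exchange relation of half-currents in two proportional variables. -/
theorem current_exchange {y : ℤ → A} {p : ℂ}
    (hy : ∀ k l, y (k + 1) * y l - p • (y l * y (k + 1)) =
      p • (y k * y (l + 1)) - y (l + 1) * y k) (c d : ℂ) (k l : ℤ) :
    scaleX c (current y (k + 1)) * scaleX d (current y l) -
        p • (scaleX d (current y l) * scaleX c (current y (k + 1))) =
      p • (scaleX c (current y k) * scaleX d (current y (l + 1))) -
        scaleX d (current y (l + 1)) * scaleX c (current y k) := by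
  set B : ℤ → A⟦X⟧ := fun k => scaleX c (current y k) with hB
  set D : ℤ → A⟦X⟧ := fun k => scaleX d (current y k) with hD
  have hBk : ∀ k, B k = PowerSeries.C (y k) + c • mulX (B (k + 1)) := scaleX_current_eq c y
  have hDk : ∀ k, D k = PowerSeries.C (y k) + d • mulX (D (k + 1)) := scaleX_current_eq d y
  let S : ℤ → ℤ → A⟦X⟧ := fun k l =>
    B (k + 1) * D l - p • (D l * B (k + 1)) - (p • (B k * D (l + 1)) - D (l + 1) * B k)
  -- Applying 1 - dX·(shift of l) and 1 - cX·(shift of k) to the defect `S` replaces both currents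
  -- by generators, leaving exactly `hy k l`. Both operators are injective.
  have hS : ∀ l k, S k l - d • mulX (S k (l + 1)) = 0 := by
    intro l
    refine eq_zero_of_eq_smul_mulX (c := c) fun k => ?_
    have hC := congrArg (PowerSeries.C (R := A)) (hy k l)
    simp only [map_sub, map_mul, C_complex_smul] at hC
    simp only [S]
    have b0 := hBk k
    have b1 := hBk (k + 1)
    have d0 := hDk l
    have d1 := hDk (l + 1)
    generalize B (k + 1 + 1) = B2 at *
    generalize D (l + 1 + 1) = D2 at *
    generalize B (k + 1) = B1 at *
    generalize D (l + 1) = D1 at *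
    generalize B k = B0 at *
    generalize D l = D0 at *
    subst b0 d0 b1 d1
    simp only [mul_add, add_mul, smul_mul_assoc, mul_smul_comm, smul_add,
      smul_sub, mulX_mul, mul_mulX, map_add, map_sub, map_smul] at hC ⊢
    linear_combination (norm := module) hC
  have := eq_zero_of_eq_smul_mulX (c := d) (f := fun l => S k l)
    (fun l => sub_eq_zero.1 (hS l k)) l
  exact sub_eq_zero.1 this

/-- The exchange relation at equal variables and indices, with the shifted current eliminated
through c X B_{k+1} = B_k - y_k. -/
theorem current_sq {y : ℤ → A} {p : ℂ}
    (hy : ∀ k l, y (k + 1) * y l - p • (y l * y (k + 1)) =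
      p • (y k * y (l + 1)) - y (l + 1) * y k) (c : ℂ) (k : ℤ) :
    (1 - p) • (scaleX c (current y k) * scaleX c (current y k)) =
      PowerSeries.C (y k) * scaleX c (current y k) -
        p • (scaleX c (current y k) * PowerSeries.C (y k)) := by
  have h := congrArg mulX (current_exchange hy c c k k)
  have e := scaleX_current_eq c y k
  generalize scaleX c (current y (k + 1)) = B1 at *
  generalize scaleX c (current y k) = B0 at *
  have e' : PowerSeries.C (y k) = B0 - c • mulX B1 := by rw [e]; abel
  rw [e']
  simp only [mul_sub, sub_mul, smul_mul_assoc, mul_smul_comm, smul_sub, mulX_mul, mul_mulX,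
    map_sub, map_smul] at h ⊢
  linear_combination (norm := module) (c / 2) • h

/-- At the ratio p of the variables, the product in the order `current y k * scaleX p (current y k)`
drops out of the exchange relation. The remaining terms with y_k are squares by `current_sq`, and a
factor 1 - p cancels. -/
theorem current_mul_scaleX_current {y : ℤ → A} {p : ℂ} (hp : p ≠ 1)
    (hy : ∀ k l, y (k + 1) * y l - p • (y l * y (k + 1)) =
      p • (y k * y (l + 1)) - y (l + 1) * y k) (k : ℤ) :
    (1 + p) • (scaleX p (current y k) * current y k) =
      current y k * current y k + p • (scaleX p (current y k) * scaleX p (current y k)) := by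
  have h := congrArg mulX (current_exchange hy p 1 k k)
  have h1 := current_sq hy 1 k
  have h2 := current_sq hy p k
  have e1 := scaleX_current_eq p y k
  have e2 := scaleX_current_eq 1 y k
  simp only [scaleX_one] at *
  generalize scaleX p (current y (k + 1)) = B1 at *
  generalize scaleX p (current y k) = B0 at *
  generalize current y (k + 1) = D1 at *
  generalize current y k = D0 at *
  generalize PowerSeries.C (y k) = Y at *
  have f1 : p • mulX B1 = B0 - Y := by rw [e1]; abel
  have f2 : mulX D1 = D0 - Y := by rw [e2]; module
  have g1 : p • (mulX B1 * D0) = (B0 - Y) * D0 := by rw [← f1, smul_mul_assoc]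
  have g2 : p • (D0 * mulX B1) = D0 * (B0 - Y) := by rw [← f1, mul_smul_comm]
  have g3 : B0 * mulX D1 = B0 * (D0 - Y) := by rw [f2]
  have g4 : mulX D1 * B0 = (D0 - Y) * B0 := by rw [f2]
  refine smul_right_injective_of_ne (sub_ne_zero.2 hp.symm : (1 : ℂ) - p ≠ 0) ?_
  simp only [smul_add, mulX_mul, mul_mulX, mul_sub, sub_mul, map_sub, map_smul] at *
  linear_combination (norm := module) p • h - g1 + p • g2 + p ^ 2 • g3 - p • g4 - h1 - p • h2

/-! ### Powers of elements with (1 + p) b a = a² + p b² -/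

/-- Normal ordering of the products `B A^m` and `B^m A` for elements with
`(1 + p) B A = A² + p B²`. -/
theorem mul_pow_and_pow_mul {R : Type*} [Ring R] [Algebra ℂ R] {p : ℂ}
    (hp : ∀ n : ℕ, 0 < n → p ^ n ≠ 1) {a b : R}
    (h : (1 + p) • (b * a) = a * a + p • (b * b)) (m : ℕ) :
    (1 - p ^ (m + 1)) • (b * a ^ m) =
        (1 - p ^ m) • a ^ (m + 1) + (p ^ m * (1 - p)) • b ^ (m + 1) ∧
      (1 - p ^ (m + 1)) • (b ^ m * a) =
        (1 - p) • a ^ (m + 1) + (p * (1 - p ^ m)) • b ^ (m + 1) := by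
  have h1p : (1 : ℂ) - p ≠ 0 := sub_ne_zero.2 (by simpa using (hp 1 one_pos).symm)
  induction m with
  | zero => simp
  | succ m ih =>
    -- The general step divides by 1 - p^m, so m = 0 is treated apart.
    rcases Nat.eq_zero_or_pos m with rfl | hm
    · simp only [zero_add, pow_succ, pow_zero, one_mul]
      constructor <;> linear_combination (norm := module) (1 - p) • h
    · obtain ⟨h1, h2⟩ := ih
      -- `e1` and `e2` form a linear system in b a^(m+1) and b^(m+1) a, with determinant (1 - p^m)(1
      -- - p^(m+2)).
      have e1 := congrArg (· * a) h1
      have e2 := congrArg (b * ·) h2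
      simp only [smul_mul_assoc, add_mul, mul_smul_comm, mul_add, mul_assoc, ← pow_succ] at e1 e2
      simp only [← mul_assoc, ← pow_succ'] at e1 e2
      have hm' : (1 : ℂ) - p ^ m ≠ 0 := sub_ne_zero.2 (hp m hm).symm
      have hm1 : (1 : ℂ) - p ^ (m + 1) ≠ 0 := sub_ne_zero.2 (hp _ m.succ_pos).symm
      have hu : (1 - p ^ (m + 1 + 1)) • (b * a ^ (m + 1)) =
          (1 - p ^ (m + 1)) • a ^ (m + 1 + 1) + (p ^ (m + 1) * (1 - p)) • b ^ (m + 1 + 1) := by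
        refine smul_right_injective_of_ne hm' ?_
        linear_combination (norm := skip) (1 - p ^ (m + 1)) • e1 + (p ^ m * (1 - p)) • e2
        match_scalars <;> ring
      refine ⟨hu, smul_right_injective_of_ne hm1 ?_⟩
      linear_combination (norm := skip) (1 - p ^ (m + 1 + 1)) • e2 + (1 - p) • hu
      match_scalars <;> ring

theorem sub_smul_mul_pow {R : Type*} [Ring R] [Algebra ℂ R] {p : ℂ}
    (hp : ∀ n : ℕ, 0 < n → p ^ n ≠ 1) {a b : R}
    (h : (1 + p) • (b * a) = a * a + p • (b * b)) (m : ℕ) :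
    (1 - p ^ (m + 1)) • ((a - p • b) * a ^ m) =
      (1 - p) • (a ^ (m + 1) - p ^ (m + 1) • b ^ (m + 1)) := by
  have h1 := (mul_pow_and_pow_mul hp h m).1
  rw [sub_mul, smul_mul_assoc, ← pow_succ']
  linear_combination (norm := skip) (-p) • h1
  match_scalars <;> ring

theorem sum_pow_mul_mul_pow_succ {R : Type*} [Ring R] (a c : R) (m : ℕ) :
    ∑ i ∈ Finset.range (m + 1 + 1), a ^ i * c * a ^ (m + 1 - i) =
      (∑ i ∈ Finset.range (m + 1), a ^ i * c * a ^ (m - i)) * a + a ^ (m + 1) * c := by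
  rw [Finset.sum_range_succ, Finset.sum_mul, Nat.sub_self, pow_zero, mul_one]
  congr 1
  refine Finset.sum_congr rfl fun i hi => ?_
  rw [Nat.succ_sub (Nat.lt_succ_iff.1 (Finset.mem_range.1 hi)), pow_succ, mul_assoc, mul_assoc,
    mul_assoc]

/-- If `c` is moved through `a` according to `c a = ((1 + p) b - a) c`, where
`(1 + p) b a = a² + p b²`, then symmetrising `c` over the positions in a power of `a`
gives a power of `b`. -/
theorem sum_pow_mul_mul_pow {R : Type*} [Ring R] [Algebra ℂ R] {p : ℂ}
    (hp : ∀ n : ℕ, 0 < n → p ^ n ≠ 1) {a b c : R}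
    (h : (1 + p) • (b * a) = a * a + p • (b * b))
    (hc : c * a = ((1 + p) • b - a) * c) (m : ℕ) :
    (1 - p) • ∑ i ∈ Finset.range (m + 1), a ^ i * c * a ^ (m - i) =
      (1 - p ^ (m + 1)) • (b ^ m * c) := by
  induction m with
  | zero => simp
  | succ m ih =>
    have e := congrArg (· * a) ih
    have h2 := congrArg (· * c) (mul_pow_and_pow_mul hp h m).2
    simp only [smul_mul_assoc, add_mul, mul_assoc, hc] at e h2
    rw [sum_pow_mul_mul_pow_succ, smul_add, ← smul_mul_assoc, ih]
    simp only [smul_mul_assoc, mul_assoc, hc, sub_mul, mul_sub,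
      mul_smul_comm]
    simp only [← mul_assoc, ← pow_succ] at h2 ⊢
    linear_combination (norm := skip) -h2
    match_scalars <;> ring

theorem mul_pow_eq_add_sum {R : Type*} [Ring R] {e f c : R} (h : e * f = f * e + c) (m : ℕ) :
    e * f ^ (m + 1) = f ^ (m + 1) * e + ∑ i ∈ Finset.range (m + 1), f ^ i * c * f ^ (m - i) := by
  induction m with
  | zero => simpa using h
  | succ m ih =>
    rw [sum_pow_mul_mul_pow_succ, pow_succ f (m + 1), ← mul_assoc, ih, add_mul, mul_assoc (f ^ (m + 1)) e f, h]
    simp only [mul_add, ← mul_assoc]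
    abel

/-! ### Currents against Cartan series and solutions of q-difference equations -/

theorem mul_units_inv_of_mul_eq_smul {k : Aˣ} {a : A} {p : ℂ} (h : k * a = p • (a * k)) :
    a * (↑k⁻¹ : A) = p • ((↑k⁻¹ : A) * a) := by
  have := congrArg (fun x => (↑k⁻¹ : A) * x * (↑k⁻¹ : A)) h
  simpa [mul_assoc, ← mul_assoc] using this

/-- The relations between a Cartan series and a current, after normalisation of the
constant term to `1`. -/
theorem normalised_exchange {y : ℤ → A} {ψ : ℕ → A} {k : Aˣ} {p : ℂ} (hp : p ≠ 0) (h0 : ψ 0 = k)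
    (hk : ∀ l, k * y l = p • (y l * k))
    (h : ∀ n l, ψ (n + 1) * y l - p • (y l * ψ (n + 1)) =
      p • (ψ n * y (l + 1)) - y (l + 1) * ψ n) (l : ℤ) :
    (PowerSeries.mk fun n => (↑k⁻¹ : A) * ψ n) * PowerSeries.C (y l) -
        p • mulX ((PowerSeries.mk fun n => (↑k⁻¹ : A) * ψ n) * PowerSeries.C (y (l + 1))) =
      PowerSeries.C (y l) * (PowerSeries.mk fun n => (↑k⁻¹ : A) * ψ n) -
        p⁻¹ • mulX (PowerSeries.C (y (l + 1)) * (PowerSeries.mk fun n => (↑k⁻¹ : A) * ψ n)) := by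
  have hk' := fun l => mul_units_inv_of_mul_eq_smul (hk l)
  ext n
  cases n with
  | zero => simp [h0]
  | succ n =>
    simp only [map_sub, coeff_complex_smul, coeff_succ_mulX, PowerSeries.coeff_mul_C,
      PowerSeries.coeff_C_mul, PowerSeries.coeff_mk]
    rw [← mul_assoc (y l), ← mul_assoc (y (l + 1)), hk', hk']
    have e := congrArg ((↑k⁻¹ : A) * ·) (h n l)
    simp only [mul_sub, mul_smul_comm, smul_mul_assoc, ← mul_assoc] at e ⊢
    rw [smul_smul, inv_mul_cancel₀ hp]
    linear_combination (norm := module) e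

variable {y : ℤ → A} {Ψ P : A⟦X⟧} {p : ℂ}

/-- Passing a current through a normalised Cartan series. -/
theorem mul_current (hp : p ≠ 0)
    (h : ∀ l, Ψ * PowerSeries.C (y l) - p • mulX (Ψ * PowerSeries.C (y (l + 1))) =
      PowerSeries.C (y l) * Ψ - p⁻¹ • mulX (PowerSeries.C (y (l + 1)) * Ψ)) (l : ℤ) :
    p • (Ψ * current y l) = ((1 + p) • scaleX p (current y l) - current y l) * Ψ := by
  let S : ℤ → A⟦X⟧ := fun l =>
    p • (Ψ * current y l) - ((1 + p) • scaleX p (current y l) - current y l) * Ψ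
  -- One shift operator, 1 - X·(shift), removes the tail of the current, the other, 1 - pX·(shift),
  -- that of its rescaling; the residue is p times `h l`.
  have hS : ∀ l, S l - (1 : ℂ) • mulX (S (l + 1)) = 0 := by
    refine eq_zero_of_eq_smul_mulX (c := p) fun l => ?_
    simp only [S]
    have a0 := current_eq y l
    have a1 := current_eq y (l + 1)
    have b0 := scaleX_current_eq p y l
    have b1 := scaleX_current_eq p y (l + 1)
    have hl := h l
    generalize scaleX p (current y (l + 1 + 1)) = B2 at *
    generalize current y (l + 1 + 1) = D2 at *
    generalize scaleX p (current y (l + 1)) = B1 at *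
    generalize current y (l + 1) = D1 at *
    generalize scaleX p (current y l) = B0 at *
    generalize current y l = D0 at *
    subst b0 a0 b1 a1
    have hl' := congrArg (p • ·) hl
    simp only [mul_add, add_mul, sub_mul, smul_mul_assoc, smul_add,
      smul_sub, mulX_mul, mul_mulX, map_add, map_sub, map_smul, smul_smul,
      mul_inv_cancel₀ hp] at hl' ⊢
    linear_combination (norm := module) hl'
  exact sub_eq_zero.1 (eq_zero_of_eq_smul_mulX (c := 1) (f := S) (fun l => sub_eq_zero.1 (hS l)) l)

/-- Passing a current through the solution of a `q`-difference equation. -/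
theorem current_mul_cp (hp0 : p ≠ 0) (hp : ∀ n : ℕ, 0 < n → p ^ n ≠ 1)
    (hΨ : PowerSeries.coeff 0 Ψ = 1) (hP0 : PowerSeries.coeff 0 P = 1) (hP : scaleX p P = Ψ * P)
    (h : ∀ l, Ψ * PowerSeries.C (y l) - p • mulX (Ψ * PowerSeries.C (y (l + 1))) =
      PowerSeries.C (y l) * Ψ - p⁻¹ • mulX (PowerSeries.C (y (l + 1)) * Ψ)) (l : ℤ) :
    current y l * P = P * (PowerSeries.C (y l) - p⁻¹ • mulX (PowerSeries.C (y (l + 1)))) := by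
  -- With σ = X·(shift of l), this says y_l P = P (1 - σ)(1 - p⁻¹σ) y_l. The current is (1 - σ)⁻¹
  -- y_l, which cancels one factor.
  have h1 : ∀ l, PowerSeries.C (y l) * P - P * (PowerSeries.C (y l) -
      (1 + p⁻¹) • mulX (PowerSeries.C (y (l + 1))) +
      p⁻¹ • mulX (mulX (PowerSeries.C (y (l + 1 + 1))))) = 0 := by
    refine eq_zero_of_scaleX_eq (a := p⁻¹) (b := p) hp hΨ (fun l => ?_) fun l => ?_
    · simp at hP0 ⊢
      simp [hP0]
    · have hl := congrArg (· * P) (h l)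
      simp only [map_sub, map_add, map_mul, map_smul, scaleX_C, scaleX_mulX, hP]
      simp only [mul_add, add_mul, mul_sub, sub_mul, smul_mul_assoc, mul_smul_comm, smul_add,
        smul_sub, mulX_mul, mul_mulX, map_add, map_sub, map_smul, smul_smul, mul_assoc] at hl ⊢
      linear_combination (norm := skip) -hl
      match_scalars <;> field_simp <;> ring
  refine sub_eq_zero.1 (eq_zero_of_eq_smul_mulX (c := 1) (f := fun l => current y l * P -
    P * (PowerSeries.C (y l) - p⁻¹ • mulX (PowerSeries.C (y (l + 1))))) (fun l => ?_) l)
  have a0 := current_eq y l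
  have hl := h1 l
  generalize current y (l + 1) = D1 at *
  generalize current y l = D0 at *
  subst a0
  simp only [mul_add, add_mul, mul_sub, mul_smul_comm, smul_sub, mulX_mul, mul_mulX, map_sub,
    map_smul, smul_smul] at hl ⊢
  linear_combination (norm := module) hl

/-- With σ = X·(shift of l), the right side is P ((1 - σ)⁻¹ - p (1 - pσ)⁻¹) y_l, so by partial
fractions y_l P = P (1 - σ)⁻¹ (1 - pσ)⁻¹ y_l. Both sides solve the same q-difference recursion and
agree in degree 0. -/
theorem C_mul_cp (hp0 : p ≠ 0) (hp : ∀ n : ℕ, 0 < n → p ^ n ≠ 1)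
    (hΨ : PowerSeries.coeff 0 Ψ = 1) (hP0 : PowerSeries.coeff 0 P = 1) (hP : scaleX p⁻¹ P = Ψ * P)
    (h : ∀ l, Ψ * PowerSeries.C (y l) - p • mulX (Ψ * PowerSeries.C (y (l + 1))) =
      PowerSeries.C (y l) * Ψ - p⁻¹ • mulX (PowerSeries.C (y (l + 1)) * Ψ)) (l : ℤ) :
    (1 - p) • (PowerSeries.C (y l) * P) =
      P * (current y l - p • scaleX p (current y l)) := by
  refine sub_eq_zero.1 (eq_zero_of_scaleX_eq (c := p⁻¹) (a := p⁻¹) (b := p) (g := Ψ)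
    (f := fun l => (1 - p) • (PowerSeries.C (y l) * P) -
      P * (current y l - p • scaleX p (current y l))) (fun n hn => ?_) hΨ (fun l => ?_)
      (fun l => ?_) l)
  · rw [inv_pow]
    exact fun h => hp n hn (inv_eq_one.1 h)
  · simp [current] at hP0 ⊢
    simp [hP0, sub_smul]
  · have hl := congrArg (· * P) (h l)
    simp only [map_sub, map_mul, map_smul, scaleX_C, hP, scaleX_scaleX, inv_mul_cancel₀ hp0,
      scaleX_one]
    have a0 := current_eq y l
    have b0 := scaleX_current_eq p⁻¹ y l
    have c0 := scaleX_current_eq p y l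
    generalize scaleX p (current y (l + 1)) = C1 at *
    generalize scaleX p⁻¹ (current y (l + 1)) = B1 at *
    generalize current y (l + 1) = D1 at *
    generalize scaleX p (current y l) = C0 at *
    generalize scaleX p⁻¹ (current y l) = B0 at *
    generalize current y l = D0 at *
    subst b0 a0 c0
    simp only [mul_add, mul_sub, sub_mul, smul_mul_assoc, mul_smul_comm, smul_add,
      smul_sub, mulX_mul, mul_mulX, map_sub, map_smul, smul_smul, mul_assoc] at hl ⊢
    linear_combination (norm := skip) (p - 1) • hl
    match_scalars <;> field_simp <;> ring

end Generic

/-! ### Specialisation to the quantum loop algebra -/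

section Loop

variable (q : ℂ)

theorem E_exchange (k l : ℤ) : E q (k + 1) * E q l - (q ^ 2) • (E q l * E q (k + 1)) =
    (q ^ 2) • (E q k * E q (l + 1)) - E q (l + 1) * E q k := by
  have h := mkU_rel (Rel.E_E (q := q) k l)
  simpa only [map_sub, map_mul, map_smul, zpow_ofNat, E] using h

theorem zpow_neg_two_eq : q ^ (-2 : ℤ) = (q ^ 2)⁻¹ := by
  rw [zpow_neg, zpow_ofNat]

theorem F_exchange (k l : ℤ) : F q (k + 1) * F q l - (q ^ 2)⁻¹ • (F q l * F q (k + 1)) =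
    (q ^ 2)⁻¹ • (F q k * F q (l + 1)) - F q (l + 1) * F q k := by
  have h := mkU_rel (Rel.F_F (q := q) k l)
  simpa only [map_sub, map_mul, map_smul, zpow_neg_two_eq, F] using h

theorem K_mul_E (k : ℤ) : (K q : U q) * E q k = (q ^ 2) • (E q k * K q) := by
  have h := congrArg (· * (K q : U q)) (mkU_rel (Rel.weight_E (q := q) 1 k))
  simp only [map_mul, map_smul, Units.val_one, mul_one, zpow_ofNat, smul_mul_assoc] at h
  rw [mul_assoc] at h
  have e := congrArg ((K q : U q) * E q k * ·) (psi_neg_mul_psi q)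
  simp only [mul_one] at e
  exact e.symm.trans h

theorem K_mul_F (k : ℤ) : (K q : U q) * F q k = (q ^ 2)⁻¹ • (F q k * K q) := by
  have h := congrArg (· * (K q : U q)) (mkU_rel (Rel.weight_F (q := q) 1 k))
  simp only [map_mul, map_smul, Units.val_one, mul_one, zpow_neg_two_eq, smul_mul_assoc] at h
  rw [mul_assoc] at h
  have e := congrArg ((K q : U q) * F q k * ·) (psi_neg_mul_psi q)
  simp only [mul_one] at e
  exact e.symm.trans h

theorem psi_E_exchange (n : ℕ) (l : ℤ) :
    psi q 1 (n + 1 : ℕ) * E q l - (q ^ 2) • (E q l * psi q 1 (n + 1 : ℕ)) =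
      (q ^ 2) • (psi q 1 n * E q (l + 1)) - E q (l + 1) * psi q 1 n := by
  have h := mkU_rel (Rel.psi_E (q := q) 1 n l (Or.inl ⟨rfl, by positivity⟩))
  simpa only [map_sub, map_mul, map_smul, zpow_ofNat, E, psi, Nat.cast_succ] using h

theorem psi_F_exchange (n : ℕ) (l : ℤ) :
    psi q 1 (n + 1 : ℕ) * F q l - (q ^ 2)⁻¹ • (F q l * psi q 1 (n + 1 : ℕ)) =
      (q ^ 2)⁻¹ • (psi q 1 n * F q (l + 1)) - F q (l + 1) * psi q 1 n := by
  have h := mkU_rel (Rel.psi_F (q := q) 1 n l (Or.inl ⟨rfl, by positivity⟩))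
  simpa only [map_sub, map_mul, map_smul, zpow_neg_two_eq, F, psi, Nat.cast_succ] using h

theorem psi_commute (n m : ℤ) : Commute (psi q 1 n) (psi q 1 m) := by
  have h := mkU_rel (Rel.psi_comm (q := q) 1 1 n m)
  simp only [map_mul] at h
  exact h

theorem psi_neg_one_succ (n : ℕ) : psi q (-1) (n + 1 : ℕ) = 0 := by
  have : ¬ (0 : ℤ) ≤ ((-1 : ℤˣ) : ℤ) * ((n + 1 : ℕ) : ℤ) := by
    push_cast
    omega
  rw [psi, Free.psi, if_neg this, map_zero]

theorem E_zero_mul_F (n : ℕ) : E q 0 * F q (1 + n) =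
    F q (1 + n) * E q 0 + (q - q⁻¹)⁻¹ • psi q 1 (n + 1 : ℕ) := by
  have h := mkU_rel (Rel.E_F (q := q) 0 (1 + n))
  simp only [map_sub, map_mul, map_smul] at h
  have h0 := psi_neg_one_succ q n
  have e : (0 : ℤ) + (1 + (n : ℤ)) = ((n + 1 : ℕ) : ℤ) := by push_cast; ring
  rw [e] at h
  rw [← sub_eq_iff_eq_add']
  refine h.trans ?_
  rw [show mkU q (Free.psi (-1) ((n + 1 : ℕ) : ℤ)) = 0 from h0, sub_zero]
  rfl

/-- The half-current `∑_{n ≥ 0} F_{n+1} z^{-n}`. -/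
def FPlus : (U q)⟦X⟧ := current (F q) 1

theorem EPlus_eq : EPlus q = current (E q) 0 := by
  ext n
  simp [EPlus, current]

theorem psiBar_mul_E (hq0 : q ≠ 0) (l : ℤ) :
    psiBar q * PowerSeries.C (E q l) - q ^ 2 • mulX (psiBar q * PowerSeries.C (E q (l + 1))) =
      PowerSeries.C (E q l) * psiBar q -
        (q ^ 2)⁻¹ • mulX (PowerSeries.C (E q (l + 1)) * psiBar q) :=
  normalised_exchange (ψ := fun n => psi q 1 n) (pow_ne_zero 2 hq0) rfl (K_mul_E q)
    (psi_E_exchange q) l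

theorem psiBar_mul_F (hq0 : q ≠ 0) (l : ℤ) :
    psiBar q * PowerSeries.C (F q l) -
        (q ^ 2)⁻¹ • mulX (psiBar q * PowerSeries.C (F q (l + 1))) =
      PowerSeries.C (F q l) * psiBar q -
        (q ^ 2)⁻¹⁻¹ • mulX (PowerSeries.C (F q (l + 1)) * psiBar q) :=
  normalised_exchange (ψ := fun n => psi q 1 n) (inv_ne_zero (pow_ne_zero 2 hq0)) rfl (K_mul_F q)
    (psi_F_exchange q) l

theorem dilate_eq (c : ℂ) (f : (U q)⟦X⟧) : dilate c f = scaleX c⁻¹ f := by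
  ext n
  rw [dilate, PowerSeries.coeff_mk, coeff_scaleX, zpow_neg, zpow_natCast, inv_pow]

theorem commute_K_cpCoeff (n : ℕ) : Commute (K q : U q) (cpCoeff q n) := by
  induction n using Nat.strong_induction_on with
  | _ n ih =>
    cases n with
    | zero => rw [cpCoeff]; exact Commute.one_right _
    | succ n =>
      rw [cpCoeff]
      refine Commute.smul_right (Commute.sum_right _ _ _ fun k _ => ?_) _
      refine Commute.mul_right ?_ (ih k k.2)
      rw [psiBar, PowerSeries.coeff_mk]
      exact ((Commute.refl (K q : U q)).units_inv_right).mul_right (psi_commute q 0 _)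

theorem commute_C_K_cpSeries : Commute (PowerSeries.C (K q : U q)) (cpSeries q) := by
  ext n
  simpa [cpSeries] using (commute_K_cpCoeff q n).eq

theorem C_K_mul_current {y : ℤ → U q} {p : ℂ} (h : ∀ k, (K q : U q) * y k = p • (y k * K q))
    (c : ℂ) (l : ℤ) : PowerSeries.C (K q : U q) * scaleX c (current y l) =
      p • (scaleX c (current y l) * PowerSeries.C (K q : U q)) := by
  ext n
  simp only [PowerSeries.coeff_C_mul, PowerSeries.coeff_mul_C, coeff_complex_smul, coeff_scaleX,
    current, PowerSeries.coeff_mk, mul_smul_comm, smul_mul_assoc, h]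
  rw [smul_comm]

variable {q}

theorem sq_pow_ne_one (hq : ∀ n : ℕ, 0 < n → q ^ n ≠ 1) (n : ℕ) (hn : 0 < n) :
    (q ^ 2) ^ n ≠ 1 := by
  rw [← pow_mul]
  exact hq _ (by omega)

theorem sq_inv_pow_ne_one (hq : ∀ n : ℕ, 0 < n → q ^ n ≠ 1) (n : ℕ) (hn : 0 < n) :
    ((q ^ 2)⁻¹) ^ n ≠ 1 := by
  rw [inv_pow]
  exact fun h => sq_pow_ne_one hq n hn (inv_eq_one.1 h)

theorem scaleX_cpSeries (hq : ∀ n : ℕ, 0 < n → q ^ n ≠ 1) :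
    scaleX (q ^ 2)⁻¹ (cpSeries q) = psiBar q * cpSeries q := by
  rw [← ((eq_cpSeries_iff hq _).1 rfl).2, dilate_eq]

theorem coeff_zero_cpSeries : PowerSeries.coeff 0 (cpSeries q) = 1 := by
  rw [cpSeries, PowerSeries.coeff_mk, cpCoeff]

theorem FPlus_mul_cpSeries (hq0 : q ≠ 0) (hq : ∀ n : ℕ, 0 < n → q ^ n ≠ 1) :
    FPlus q * cpSeries q = cpSeries q *
      (PowerSeries.C (F q 1) - q ^ 2 • mulX (PowerSeries.C (F q 2))) := by
  have := current_mul_cp (inv_ne_zero (pow_ne_zero 2 hq0)) (sq_inv_pow_ne_one hq)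
    (coeff_zero_psiBar q) coeff_zero_cpSeries (scaleX_cpSeries hq) (psiBar_mul_F q hq0) 1
  rwa [inv_inv] at this

theorem C_E_mul_cpSeries (hq0 : q ≠ 0) (hq : ∀ n : ℕ, 0 < n → q ^ n ≠ 1) :
    (1 - q ^ 2) • (PowerSeries.C (E q 0) * cpSeries q) =
      cpSeries q * (EPlus q - q ^ 2 • scaleX (q ^ 2) (EPlus q)) := by
  rw [EPlus_eq]
  exact C_mul_cp (pow_ne_zero 2 hq0) (sq_pow_ne_one hq)
    (coeff_zero_psiBar q) coeff_zero_cpSeries (scaleX_cpSeries hq) (psiBar_mul_E q hq0) 0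

theorem sq_ne_one (hq : ∀ n : ℕ, 0 < n → q ^ n ≠ 1) : q ^ 2 ≠ 1 := hq 2 two_pos

theorem sq_inv_ne_one (hq : ∀ n : ℕ, 0 < n → q ^ n ≠ 1) : (q ^ 2)⁻¹ ≠ 1 :=
  fun h => hq 2 two_pos (inv_eq_one.1 h)

theorem sub_inv_ne_zero (hq0 : q ≠ 0) (hq : ∀ n : ℕ, 0 < n → q ^ n ≠ 1) : q - q⁻¹ ≠ 0 := by
  intro h
  refine hq 2 two_pos ?_
  field_simp at h
  linear_combination h

/-- Commuting `E_0` past the Chari-Pressley series in front of a power of `E^+`. -/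
theorem C_E_mul_cpSeries_mul_pow (hq0 : q ≠ 0) (hq : ∀ n : ℕ, 0 < n → q ^ n ≠ 1) (b : ℕ) :
    (1 - (q ^ 2) ^ (b + 1)) • (PowerSeries.C (E q 0) * cpSeries q * EPlus q ^ b) =
      cpSeries q *
        (EPlus q ^ (b + 1) - (q ^ 2) ^ (b + 1) • scaleX (q ^ 2) (EPlus q) ^ (b + 1)) := by
  have h1 := congrArg (· * EPlus q ^ b) (C_E_mul_cpSeries hq0 hq)
  have h2 := congrArg (cpSeries q * ·) (sub_smul_mul_pow (sq_pow_ne_one hq)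
    (current_mul_scaleX_current (sq_ne_one hq) (E_exchange q) 0) b)
  rw [← EPlus_eq] at h2
  refine smul_right_injective_of_ne (sub_ne_zero.2 (sq_ne_one hq).symm) ?_
  simp only [smul_mul_assoc, mul_smul_comm, mul_assoc] at h1 h2 ⊢
  rw [← h2, ← h1, smul_comm]

/-- Commuting `E_0` past a power of the half-current of the `F_n`. -/
theorem mulX_C_E_mul_FPlus_pow (hq0 : q ≠ 0) (hq : ∀ n : ℕ, 0 < n → q ^ n ≠ 1) (a : ℕ) :
    ((1 - (q ^ 2)⁻¹) * (q - q⁻¹)) • mulX (PowerSeries.C (E q 0) * FPlus q ^ (a + 1) -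
        FPlus q ^ (a + 1) * PowerSeries.C (E q 0)) =
      (1 - ((q ^ 2)⁻¹) ^ (a + 1)) • (scaleX (q ^ 2)⁻¹ (FPlus q) ^ a *
        (PowerSeries.C (K q : U q) * psiBar q) - FPlus q ^ a * PowerSeries.C (K q : U q)) := by
  have hqq := sub_inv_ne_zero hq0 hq
  have hp0 : (q ^ 2)⁻¹ ≠ 0 := inv_ne_zero (pow_ne_zero 2 hq0)
  set c : (U q)⟦X⟧ := PowerSeries.C (E q 0) * FPlus q - FPlus q * PowerSeries.C (E q 0) with hc
  -- The brackets [E_0, F_{n+1}] only involve ψ⁺_{n+1}, as ψ⁻ vanishes in positive degree. The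
  -- factor X aligns the degrees, and the constant term K of ψ⁺ must be removed.
  have hmc : (q - q⁻¹) • mulX c =
      PowerSeries.C (K q : U q) * psiBar q - PowerSeries.C (K q : U q) := by
    ext n
    cases n with
    | zero =>
      have := coeff_zero_psiBar q
      simp at this
      simp [this]
    | succ n =>
      simp only [coeff_complex_smul, coeff_succ_mulX, hc, map_sub, FPlus, current,
        PowerSeries.coeff_mul_C, PowerSeries.coeff_C_mul, PowerSeries.coeff_mk, E_zero_mul_F,
        psiBar, PowerSeries.coeff_C, Units.mul_inv_cancel_left, add_sub_cancel_left, smul_smul,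
        mul_inv_cancel₀ hqq, one_smul]
      simp
  have hK : PowerSeries.C (K q : U q) * FPlus q =
      (q ^ 2)⁻¹ • (FPlus q * PowerSeries.C (K q : U q)) := by
    simpa [FPlus] using C_K_mul_current q (K_mul_F q) 1 1
  have hK' : PowerSeries.C (K q : U q) * scaleX (q ^ 2)⁻¹ (FPlus q) =
      (q ^ 2)⁻¹ • (scaleX (q ^ 2)⁻¹ (FPlus q) * PowerSeries.C (K q : U q)) :=
    C_K_mul_current q (K_mul_F q) _ 1
  have hΨ : PowerSeries.C (K q : U q) * psiBar q * FPlus q =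
      ((1 + (q ^ 2)⁻¹) • scaleX (q ^ 2)⁻¹ (FPlus q) - FPlus q) *
        (PowerSeries.C (K q : U q) * psiBar q) := by
    have h := congrArg (PowerSeries.C (K q : U q) * ·) (mul_current hp0 (psiBar_mul_F q hq0) 1)
    refine smul_right_injective_of_ne hp0 ?_
    simp only [mul_smul_comm, sub_mul, mul_sub, smul_mul_assoc] at h ⊢
    rw [mul_assoc]
    refine h.trans ?_
    simp only [← mul_assoc]
    rw [show current (F q) 1 = FPlus q from rfl, hK, hK']
    simp only [smul_mul_assoc]
    module
  have hF := current_mul_scaleX_current (sq_inv_ne_one hq) (F_exchange q) 1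
  rw [← FPlus] at hF
  have h1 := sum_pow_mul_mul_pow (sq_inv_pow_ne_one hq) hF hΨ a
  -- K F⁺ = p F⁺ K is the same exchange rule in the degenerate case b = a.
  have h2 := sum_pow_mul_mul_pow (a := FPlus q) (b := FPlus q) (c := PowerSeries.C (K q : U q))
    (sq_inv_pow_ne_one hq) (by module)
    (by rw [hK, sub_mul, smul_mul_assoc]; module) a
  rw [mul_pow_eq_add_sum (c := c) (by rw [hc]; abel) a, add_sub_cancel_left, mul_smul, map_sum,
    Finset.smul_sum]
  have hs : ∀ i ∈ Finset.range (a + 1),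
      (q - q⁻¹) • mulX (FPlus q ^ i * c * FPlus q ^ (a - i)) =
        FPlus q ^ i * (PowerSeries.C (K q : U q) * psiBar q) * FPlus q ^ (a - i) -
          FPlus q ^ i * PowerSeries.C (K q : U q) * FPlus q ^ (a - i) := by
    intro i _
    rw [← mulX_mul, ← mul_mulX, ← smul_mul_assoc, ← mul_smul_comm, hmc, mul_sub, sub_mul]
  rw [Finset.sum_congr rfl hs, Finset.sum_sub_distrib, smul_sub, h1, h2, smul_sub]

end Loop

/-! ### Divided powers -/

theorem qFactorial_succ (q : ℂ) (n : ℕ) :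
    qFactorial q (n + 1) = qFactorial q n * qInt q (n + 1) :=
  Finset.prod_range_succ _ _

theorem divPow_zero {A : Type*} [Ring A] [Algebra ℂ A] (q : ℂ) (x : A) : divPow q x 0 = 1 := by
  simp [divPow, qFactorial]

theorem map_divPow {A B : Type*} [Ring A] [Algebra ℂ A] [Ring B] [Algebra ℂ B] (f : A →ₐ[ℂ] B)
    (q : ℂ) (x : A) (n : ℕ) : f (divPow q x n) = divPow q (f x) n := by
  simp [divPow]

section Loop

variable {q : ℂ}

theorem one_sub_sq_ne_zero (hq : ∀ n : ℕ, 0 < n → q ^ n ≠ 1) : 1 - q ^ 2 ≠ 0 :=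
  sub_ne_zero.2 (hq 2 two_pos).symm

theorem qInt_succ_mul (hq0 : q ≠ 0) (hq : ∀ n : ℕ, 0 < n → q ^ n ≠ 1) (b : ℕ) :
    qInt q (b + 1) * (q ^ b * (1 - q ^ 2)) = 1 - (q ^ 2) ^ (b + 1) := by
  have h := sub_inv_ne_zero hq0 hq
  have h2 := one_sub_sq_ne_zero hq
  have h' : q ^ 2 - 1 ≠ 0 := fun e => h2 (by linear_combination -e)
  rw [qInt]
  field_simp
  ring

theorem qInt_succ_ne_zero (hq0 : q ≠ 0) (hq : ∀ n : ℕ, 0 < n → q ^ n ≠ 1) (b : ℕ) :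
    qInt q (b + 1) ≠ 0 := by
  intro h
  have := qInt_succ_mul hq0 hq b
  rw [h, zero_mul] at this
  exact sq_pow_ne_one hq (b + 1) b.succ_pos (sub_eq_zero.1 this.symm).symm

theorem qFactorial_ne_zero (hq0 : q ≠ 0) (hq : ∀ n : ℕ, 0 < n → q ^ n ≠ 1) (b : ℕ) :
    qFactorial q b ≠ 0 :=
  Finset.prod_ne_zero_iff.2 fun _ _ => qInt_succ_ne_zero hq0 hq _

theorem C_E_mul_cpSeries_mul_divPow (hq0 : q ≠ 0) (hq : ∀ n : ℕ, 0 < n → q ^ n ≠ 1) (b : ℕ) :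
    PowerSeries.C (E q 0) * cpSeries q * divPow q (EPlus q) b =
      (q ^ b * (1 - q ^ 2))⁻¹ • (cpSeries q * (divPow q (EPlus q) (b + 1) -
        (q ^ 2) ^ (b + 1) • divPow q (scaleX (q ^ 2) (EPlus q)) (b + 1))) := by
  have h := C_E_mul_cpSeries_mul_pow hq0 hq b
  have h1 := qInt_succ_mul hq0 hq b
  have h2 := qInt_succ_ne_zero hq0 hq b
  have h3 := qFactorial_ne_zero hq0 hq b
  have h4 : q ^ b * (1 - q ^ 2) ≠ 0 := mul_ne_zero (pow_ne_zero _ hq0) (one_sub_sq_ne_zero hq)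
  generalize q ^ b * (1 - q ^ 2) = w at *
  refine smul_right_injective_of_ne (mul_ne_zero h2 h4) ?_
  simp only [divPow, mul_smul_comm, mul_sub, smul_sub, smul_smul, qFactorial_succ] at h ⊢
  linear_combination (norm := skip) (qFactorial q b)⁻¹ • h
  rw [← h1]
  match_scalars <;> field_simp <;> ring

theorem mulX_C_E_mul_FPlus_divPow (hq0 : q ≠ 0) (hq : ∀ n : ℕ, 0 < n → q ^ n ≠ 1) (a : ℕ) :
    mulX (PowerSeries.C (E q 0) * divPow q (FPlus q) (a + 1) -
        divPow q (FPlus q) (a + 1) * PowerSeries.C (E q 0)) =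
      (q ^ a * (q - q⁻¹))⁻¹ • (divPow q (scaleX (q ^ 2)⁻¹ (FPlus q)) a *
        (PowerSeries.C (K q : U q) * psiBar q) -
          divPow q (FPlus q) a * PowerSeries.C (K q : U q)) := by
  have h := mulX_C_E_mul_FPlus_pow hq0 hq a
  have h2 := qInt_succ_ne_zero hq0 hq a
  have h3 := qFactorial_ne_zero hq0 hq a
  have h4 : q ^ a ≠ 0 := pow_ne_zero _ hq0
  have h5 := sub_inv_ne_zero hq0 hq
  have h6 : 1 - (q ^ 2)⁻¹ ≠ 0 := sub_ne_zero.2 (sq_inv_ne_one hq).symm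
  have h1 : qInt q (a + 1) * (1 - (q ^ 2)⁻¹) = (1 - ((q ^ 2)⁻¹) ^ (a + 1)) * q ^ a := by
    have e := qInt_succ_mul hq0 hq a
    rw [inv_pow]
    rw [show (q ^ 2) ^ (a + 1) = q ^ a * q ^ a * q ^ 2 by ring] at e ⊢
    field_simp at e ⊢
    linear_combination -e
  have h7 : 1 - ((q ^ 2)⁻¹) ^ (a + 1) = qInt q (a + 1) * (1 - (q ^ 2)⁻¹) * (q ^ a)⁻¹ := by
    rw [h1, mul_assoc, mul_inv_cancel₀ h4, mul_one]
  rw [h7] at h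
  generalize 1 - (q ^ 2)⁻¹ = w at *
  generalize q - q⁻¹ = w' at *
  refine smul_right_injective_of_ne (mul_ne_zero (mul_ne_zero h6 h5) h2) ?_
  simp only [divPow, mul_smul_comm, smul_mul_assoc, smul_sub, smul_smul, qFactorial_succ, map_sub,
    map_smul] at h ⊢
  linear_combination (norm := skip) (qFactorial q a)⁻¹ • h
  match_scalars <;> field_simp <;> ring

variable (q)

/-! ### Normal ordering -/

/-- The normally ordered product `F^+(z)^{(a)} P^+(z) E^+(c⁻¹ z)^{(b)}`. -/
def normalOrd (c : ℂ) (a b : ℕ) : (U q)⟦X⟧ :=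
  divPow q (FPlus q) a * cpSeries q * divPow q (scaleX c (EPlus q)) b

theorem normalOrd_zero_right (c d : ℂ) (a : ℕ) : normalOrd q c a 0 = normalOrd q d a 0 := by
  simp [normalOrd, divPow_zero]

theorem coeff_zero_normalOrd (c : ℂ) (a b : ℕ) : PowerSeries.coeff 0 (normalOrd q c a b) =
    divPow q (F q 1) a * divPow q (E q 0) b := by
  have h1 : PowerSeries.constantCoeff (cpSeries q) = 1 := by
    simpa using coeff_zero_cpSeries (q := q)
  have h2 : ∀ (w : ℂ) (f : (U q)⟦X⟧), PowerSeries.constantCoeff (w • f) =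
    w • PowerSeries.constantCoeff f := fun w f => rfl
  simp only [normalOrd, divPow, PowerSeries.coeff_zero_eq_constantCoeff, map_mul, h1, h2, map_pow,
    constantCoeff_scaleX, mul_one]
  simp [FPlus, EPlus, current, ← PowerSeries.coeff_zero_eq_constantCoeff_apply]

theorem C_K_mul_divPow {f : (U q)⟦X⟧} {p : ℂ} (h : PowerSeries.C (K q : U q) * f =
    p • (f * PowerSeries.C (K q : U q))) (b : ℕ) : PowerSeries.C (K q : U q) * divPow q f b =
      p ^ b • (divPow q f b * PowerSeries.C (K q : U q)) := by
  have h' : PowerSeries.C (K q : U q) * f ^ b = p ^ b • (f ^ b * PowerSeries.C (K q : U q)) := by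
    induction b with
    | zero => simp
    | succ b ih =>
      rw [pow_succ, ← mul_assoc, ih, smul_mul_assoc, mul_assoc, h, mul_smul_comm, smul_smul,
        mul_assoc, pow_succ]
  rw [divPow, mul_smul_comm, h', smul_mul_assoc, smul_comm]

theorem C_K_mul_EPlus (c : ℂ) : PowerSeries.C (K q : U q) * scaleX c (EPlus q) =
    (q ^ 2) • (scaleX c (EPlus q) * PowerSeries.C (K q : U q)) := by
  rw [EPlus_eq]
  exact C_K_mul_current q (K_mul_E q) c 0

theorem divPow_mul_C_K_mul (c : ℂ) (a b : ℕ) :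
    divPow q (FPlus q) a * (PowerSeries.C (K q : U q) * cpSeries q) *
        divPow q (scaleX c (EPlus q)) b =
      (q ^ 2) ^ b • (normalOrd q c a b * PowerSeries.C (K q : U q)) := by
  rw [(commute_C_K_cpSeries q).eq, normalOrd, mul_assoc, mul_assoc, C_K_mul_divPow q
    (C_K_mul_EPlus q c)]
  simp only [mul_smul_comm, mul_assoc]

variable {q}

/-- The first summand is E_0 crossing P⁺ and E⁺, the second its commutator with the power of F⁺.
There the series K⁻¹ψ⁺ joins P⁺ to form P⁺(q²z), so the product becomes a rescaled `normalOrd` with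
parameter q². -/
theorem mulX_C_E_mul_normalOrd (hq0 : q ≠ 0) (hq : ∀ n : ℕ, 0 < n → q ^ n ≠ 1) (a b : ℕ) :
    mulX (PowerSeries.C (E q 0) * normalOrd q 1 (a + 1) b) =
      (q ^ b * (1 - q ^ 2))⁻¹ • mulX (normalOrd q 1 (a + 1) (b + 1) -
          (q ^ 2) ^ (b + 1) • normalOrd q (q ^ 2) (a + 1) (b + 1)) +
        ((q ^ 2) ^ b * (q ^ a * (q - q⁻¹))⁻¹) •
          ((scaleX (q ^ 2)⁻¹ (normalOrd q (q ^ 2) a b) - normalOrd q 1 a b) *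
            PowerSeries.C (K q : U q)) := by
  have hE := congrArg (divPow q (FPlus q) (a + 1) * ·) (C_E_mul_cpSeries_mul_divPow hq0 hq b)
  have hF := congrArg (· * (cpSeries q * divPow q (EPlus q) b))
    (mulX_C_E_mul_FPlus_divPow hq0 hq a)
  have hK1 := divPow_mul_C_K_mul q 1 a b
  have hK2 := congrArg (scaleX (q ^ 2)⁻¹) (divPow_mul_C_K_mul q (q ^ 2) a b)
  simp only [map_mul, map_smul, map_divPow, scaleX_C, scaleX_cpSeries hq, scaleX_scaleX,
    inv_mul_cancel₀ (pow_ne_zero 2 hq0), scaleX_one] at hK1 hK2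
  have hE' := congrArg mulX hE
  rw [sub_mul, smul_mul_assoc] at *
  simp only [normalOrd, scaleX_one, map_mul, map_divPow, scaleX_cpSeries hq, scaleX_scaleX,
    inv_mul_cancel₀ (pow_ne_zero 2 hq0), mulX_mul, sub_mul, mul_sub, map_sub, map_smul,
    mul_smul_comm, smul_sub, mul_assoc] at *
  linear_combination (norm := skip) hF + hE' + (q ^ a * (q - q⁻¹))⁻¹ • (hK2 - hK1)
  match_scalars <;> ring

theorem E_mul_coeff_normalOrd (hq0 : q ≠ 0) (hq : ∀ n : ℕ, 0 < n → q ^ n ≠ 1) (a b t : ℕ) :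
    E q 0 * PowerSeries.coeff t (normalOrd q 1 (a + 1) b) =
      (q ^ b * (1 - q ^ 2))⁻¹ • (PowerSeries.coeff t (normalOrd q 1 (a + 1) (b + 1)) -
          (q ^ 2) ^ (b + 1) • PowerSeries.coeff t (normalOrd q (q ^ 2) (a + 1) (b + 1))) +
        ((q ^ 2) ^ b * (q ^ a * (q - q⁻¹))⁻¹) •
          ((((q ^ 2)⁻¹) ^ (t + 1) • PowerSeries.coeff (t + 1) (normalOrd q (q ^ 2) a b) -
            PowerSeries.coeff (t + 1) (normalOrd q 1 a b)) * K q) := by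
  have h := congrArg (PowerSeries.coeff (t + 1)) (mulX_C_E_mul_normalOrd hq0 hq a b)
  simpa only [coeff_succ_mulX, map_add, map_sub, coeff_complex_smul, PowerSeries.coeff_C_mul,
    PowerSeries.coeff_mul_C, coeff_scaleX] using h

theorem divPow_succ' {A : Type*} [Ring A] [Algebra ℂ A] (x : A) (n : ℕ) :
    divPow q x (n + 1) = (qInt q (n + 1))⁻¹ • (x * divPow q x n) := by
  rw [divPow, divPow, qFactorial_succ, pow_succ', mul_smul_comm, smul_smul, mul_inv, mul_comm]

theorem sum_range_succ_add_shift {M : Type*} [AddCommGroup M] (u v : ℕ → M) (r : ℕ)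
    (hu : u (r + 1) = 0) (hv : v 0 = 0) :
    ∑ t ∈ Finset.range (r + 1), (u t + v (t + 1)) = ∑ t ∈ Finset.range (r + 2), (u t + v t) := by
  rw [Finset.sum_add_distrib, Finset.sum_add_distrib, Finset.sum_range_succ u (r + 1),
    Finset.sum_range_succ' v (r + 1), hu, hv, add_zero, add_zero]

/-- The scalar coefficient of the `t`-th term in the normal ordering of `E_0^{(r)} F_1^{(s)}`. -/
def orderCoeff (q : ℂ) (r s t : ℕ) : ℂ :=
  (-1) ^ t * q ^ (((r : ℤ) - s) * t - (t : ℤ) ^ 2)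

/-- Normal ordering of `E_0^{(r)} F_1^{(s)}` for `r ≤ s`. -/
theorem divPow_E_mul_divPow_F (hq0 : q ≠ 0) (hq : ∀ n : ℕ, 0 < n → q ^ n ≠ 1) (s r : ℕ)
    (hrs : r ≤ s) : divPow q (E q 0) r * divPow q (F q 1) s =
      ∑ t ∈ Finset.range (r + 1), orderCoeff q r s t •
        (PowerSeries.coeff t (normalOrd q 1 (s - t) (r - t)) * (K q : U q) ^ t) := by
  induction r with
  | zero =>
    rw [Finset.sum_range_one, coeff_zero_normalOrd]
    simp [orderCoeff, divPow_zero]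
  | succ r ih =>
    rw [divPow_succ', smul_mul_assoc, mul_assoc, ih (by omega)]
    refine smul_right_injective_of_ne (qInt_succ_ne_zero hq0 hq r) ?_
    rw [smul_smul, mul_inv_cancel₀ (qInt_succ_ne_zero hq0 hq r), one_smul]
    -- `d` collects the terms with E⁺(z), `m` those with E⁺(q⁻²z). `u t` comes from E_0 crossing P⁺
    -- and E⁺, and `v (t + 1)` from its commutator with F⁺, which raises the degree by one.
    set d : ℕ → U q := fun t =>
      PowerSeries.coeff t (normalOrd q 1 (s - t) (r + 1 - t)) * (K q : U q) ^ t with hd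
    set m : ℕ → U q := fun t =>
      PowerSeries.coeff t (normalOrd q (q ^ 2) (s - t) (r + 1 - t)) * (K q : U q) ^ t with hm
    let u : ℕ → U q := fun t => (orderCoeff q r s t * q ^ ((t : ℤ) - r) / (1 - q ^ 2)) •
      (d t - q ^ (2 * ((r : ℤ) + 1 - t)) • m t)
    let v : ℕ → U q := fun t => (orderCoeff q r s t * q ^ ((r : ℤ) + t + 1) / (q - q⁻¹)) •
      (d t - q ^ (-2 * (t : ℤ)) • m t)
    have h1 := one_sub_sq_ne_zero hq
    have h2 := sub_inv_ne_zero hq0 hq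
    have h3 : q ^ 2 - 1 ≠ 0 := fun e => h1 (by linear_combination -e)
    -- At both ends `d` and `m` agree: at t = r + 1 no E⁺ is left, and at t = 0 the constant
    -- coefficient does not see the rescaling.
    have hu : u (r + 1) = 0 := by
      simp [u, hd, hm, normalOrd_zero_right q (q ^ 2) 1]
    have hv : v 0 = 0 := by
      simp only [v, hd, hm, coeff_zero_normalOrd]
      simp
    have hterm : ∀ t ∈ Finset.range (r + 1), E q 0 * (orderCoeff q r s t •
        (PowerSeries.coeff t (normalOrd q 1 (s - t) (r - t)) * (K q : U q) ^ t)) =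
          u t + v (t + 1) := by
      intro t ht
      rw [Finset.mem_range] at ht
      obtain ⟨b, rfl⟩ : ∃ b, r = t + b := ⟨r - t, by omega⟩
      -- Here r + 1 ≤ s guarantees a factor F⁺ for E_0 to cross.
      obtain ⟨a, rfl⟩ : ∃ a, s = t + (a + 1) := ⟨s - t - 1, by omega⟩
      have e1 : t + (a + 1) - t = a + 1 := by omega
      have e2 : t + b - t = b := by omega
      have e3 : t + b + 1 - t = b + 1 := by omega
      have e4 : t + (a + 1) - (t + 1) = a := by omega
      have e5 : t + b + 1 - (t + 1) = b := by omega
      rw [mul_smul_comm, ← mul_assoc, e1, e2, E_mul_coeff_normalOrd hq0 hq]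
      simp only [u, v, hd, hm, e1, e3, e4, e5, add_mul, sub_mul, smul_mul_assoc, mul_assoc,
        ← pow_succ', smul_add, smul_sub, smul_smul]
      have hQ : orderCoeff q (t + b) (t + (a + 1)) (t + 1) =
          -orderCoeff q (t + b) (t + (a + 1)) t * (q ^ b * (q ^ a)⁻¹ * ((q ^ t)⁻¹) ^ 2 *
            (q ^ 2)⁻¹) := by
        have e : q ^ b * (q ^ a)⁻¹ * ((q ^ t)⁻¹) ^ 2 * (q ^ 2)⁻¹ =
            q ^ ((b : ℤ) - a - (t * 2 : ℕ) - (2 : ℕ)) := by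
          rw [zpow_sub₀ hq0, zpow_sub₀ hq0, zpow_sub₀ hq0, inv_pow, ← pow_mul]
          simp only [zpow_natCast, div_eq_mul_inv]
        rw [orderCoeff, orderCoeff, e, neg_mul, mul_assoc, ← zpow_add₀ hq0, pow_succ, mul_neg_one,
          neg_mul]
        congr 3
        push_cast
        ring
      have z1 : q ^ ((t : ℤ) - ((t + b : ℕ) : ℤ)) = (q ^ b)⁻¹ := by
        rw [← zpow_natCast, ← zpow_neg]; congr 1; push_cast; ring
      have z2 : q ^ (2 * (((t + b : ℕ) : ℤ) + 1 - t)) = (q ^ 2) ^ (b + 1) := by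
        rw [← pow_mul, ← zpow_natCast]; congr 1; push_cast; ring
      have z3 : q ^ (((t + b : ℕ) : ℤ) + (t + 1 : ℕ) + 1) = (q ^ t) ^ 2 * q ^ b * q ^ 2 := by
        rw [← pow_mul, ← pow_add, ← pow_add, ← zpow_natCast]; congr 1; push_cast; ring
      have z4 : q ^ (-2 * ((t + 1 : ℕ) : ℤ)) = ((q ^ 2)⁻¹) ^ (t + 1) := by
        rw [inv_pow, ← pow_mul, ← zpow_natCast, ← zpow_neg]; congr 1
      rw [hQ, z1, z2, z3, z4]
      match_scalars <;> field_simp <;> ring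
    rw [Finset.mul_sum, Finset.sum_congr rfl hterm, sum_range_succ_add_shift u v r hu hv,
      Finset.smul_sum]
    refine Finset.sum_congr rfl fun t _ => ?_
    simp only [u, v]
    rw [show PowerSeries.coeff t (normalOrd q 1 (s - t) (r + 1 - t)) * (K q : U q) ^ t = d t from
      rfl]
    have hQ : orderCoeff q (r + 1) s t = orderCoeff q r s t * q ^ t := by
      rw [orderCoeff, orderCoeff, mul_assoc, ← zpow_natCast q t, ← zpow_add₀ hq0]
      congr 2
      push_cast
      ring
    have z1 : q ^ ((t : ℤ) - r) = q ^ t * (q ^ r)⁻¹ := by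
      rw [zpow_sub₀ hq0, zpow_natCast, zpow_natCast, div_eq_mul_inv]
    have z2 : q ^ (2 * ((r : ℤ) + 1 - t)) = (q ^ r) ^ 2 * q ^ 2 * ((q ^ t) ^ 2)⁻¹ := by
      rw [← pow_mul, ← pow_mul, ← pow_add, ← zpow_natCast, ← zpow_natCast, ← zpow_neg,
        ← zpow_add₀ hq0]
      congr 1; push_cast; ring
    have z3 : q ^ ((r : ℤ) + t + 1) = q ^ r * q ^ t * q := by
      rw [← pow_add, ← pow_succ, ← zpow_natCast]; congr 1
    have z4 : q ^ (-2 * (t : ℤ)) = ((q ^ t) ^ 2)⁻¹ := by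
      rw [← pow_mul, ← zpow_natCast, ← zpow_neg]; congr 1; push_cast; ring
    have z5 : q ^ (r + 1) = q ^ r * q := pow_succ q r
    -- In `u t + v t` the coefficients of `m t` cancel and those of `d t` add up to q^t [r+1].
    rw [hQ, z1, z2, z3, z4, qInt, z5]
    match_scalars <;> field_simp <;> ring

/-! ### Comparison of the two sides -/

theorem FPlus_pow_mul_cpSeries (hq0 : q ≠ 0) (hq : ∀ n : ℕ, 0 < n → q ^ n ≠ 1) (n : ℕ) :
    FPlus q ^ n * cpSeries q = cpSeries q *
      (PowerSeries.C (F q 1) - q ^ 2 • mulX (PowerSeries.C (F q 2))) ^ n := by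
  induction n with
  | zero => simp
  | succ n ih => rw [pow_succ, mul_assoc, FPlus_mul_cpSeries hq0 hq, ← mul_assoc, ih, mul_assoc,
      ← pow_succ]

/-- The summands of the normally ordered expansion in terms of `normalOrd`. -/
theorem scaleX_normalOrd_self (hq0 : q ≠ 0) (hq : ∀ n : ℕ, 0 < n → q ^ n ≠ 1) (l : ℕ) :
    scaleX (q ^ (2 * l)) (normalOrd q 1 l l) =
      dilate (q ^ (-2 * (l : ℤ))) (cpSeries q) *
        divPow q (PowerSeries.C (F q 1) -
          q ^ (2 * l + 2) • (PowerSeries.C (F q 2) * PowerSeries.X)) l *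
        divPow q (dilate (q ^ (-2 * (l : ℤ))) (EPlus q)) l := by
  have hc : (q ^ (-2 * (l : ℤ)))⁻¹ = q ^ (2 * l) := by
    rw [← zpow_neg, ← zpow_natCast]; congr 1; push_cast; ring
  have hX : PowerSeries.C (F q 2) * PowerSeries.X = mulX (PowerSeries.C (F q 2)) :=
    (PowerSeries.commute_X _).eq
  rw [dilate_eq, dilate_eq, hc, hX, normalOrd, divPow, smul_mul_assoc,
    FPlus_pow_mul_cpSeries hq0 hq]
  simp only [scaleX_one, map_mul, map_smul, map_pow, map_sub, scaleX_C, scaleX_mulX,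
    smul_smul, divPow, mul_smul_comm]
  rw [← pow_add, add_comm 2]

/-- Equal numbers of F's and E's give total weight zero: the factors q⁻²ˡ and q²ˡ cancel. -/
theorem C_K_mul_normalOrd_self (hq0 : q ≠ 0) (c : ℂ) (l : ℕ) :
    Commute (PowerSeries.C (K q : U q)) (normalOrd q c l l) := by
  have hF := C_K_mul_divPow q (by simpa using C_K_mul_current q (K_mul_F q) 1 1) l
  have h := divPow_mul_C_K_mul q c l l
  rw [← FPlus] at hF
  rw [commute_iff_eq]
  have h2 : PowerSeries.C (K q : U q) * normalOrd q c l l =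
      ((q ^ 2)⁻¹) ^ l • (divPow q (FPlus q) l * (PowerSeries.C (K q : U q) * cpSeries q) *
        divPow q (scaleX c (EPlus q)) l) := by
    rw [normalOrd, ← mul_assoc, ← mul_assoc, hF]
    simp only [smul_mul_assoc, mul_assoc]
  rw [h2, h, smul_smul, ← mul_pow, inv_mul_cancel₀ (pow_ne_zero 2 hq0), one_pow, one_smul]

theorem commute_K_coeff_normalOrd_self (hq0 : q ≠ 0) (c : ℂ) (l n : ℕ) :
    Commute (K q : U q) (PowerSeries.coeff n (normalOrd q c l l)) := by
  have h := congrArg (PowerSeries.coeff n) (C_K_mul_normalOrd_self hq0 c l).eq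
  rwa [PowerSeries.coeff_C_mul, PowerSeries.coeff_mul_C] at h

end Loop

end QLoop

end

theorem mainTheorem5 (q : ℂ) (hq0 : q ≠ 0) (hq : ∀ n : ℕ, 0 < n → q ^ n ≠ 1) :
    HasSum
      (fun l : ℕ =>
        ((-1 : ℂ) ^ l * q ^ (l ^ 2)) •
          (PowerSeries.C (((QLoop.K q) ^ (-(l : ℤ)) : (QLoop.U q)ˣ) : QLoop.U q) *
            (PowerSeries.X : (QLoop.U q)⟦X⟧) ^ l *
            QLoop.dilate (q ^ (-2 * (l : ℤ))) (QLoop.cpSeries q) *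
            QLoop.divPow q
              (PowerSeries.C (QLoop.F q 1) -
                q ^ (2 * l + 2) • (PowerSeries.C (QLoop.F q 2) * PowerSeries.X)) l *
            QLoop.divPow q (QLoop.dilate (q ^ (-2 * (l : ℤ))) (QLoop.EPlus q)) l))
      (PowerSeries.mk fun n : ℕ =>
        ((-1 : ℂ) ^ n * q ^ (n ^ 2)) •
          (QLoop.divPow q (QLoop.E q 0) n * QLoop.divPow q (QLoop.F q 1) n *
            (((QLoop.K q) ^ (-(n : ℤ)) : (QLoop.U q)ˣ) : QLoop.U q))) := by
  rw [PowerSeries.WithPiTopology.hasSum_iff_hasSum_coeff]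
  intro n
  have hterm : ∀ l : ℕ, PowerSeries.coeff n (((-1 : ℂ) ^ l * q ^ (l ^ 2)) •
      (PowerSeries.C (((QLoop.K q) ^ (-(l : ℤ)) : (QLoop.U q)ˣ) : QLoop.U q) *
        (PowerSeries.X : (QLoop.U q)⟦X⟧) ^ l *
        QLoop.dilate (q ^ (-2 * (l : ℤ))) (QLoop.cpSeries q) *
        QLoop.divPow q
          (PowerSeries.C (QLoop.F q 1) -
            q ^ (2 * l + 2) • (PowerSeries.C (QLoop.F q 2) * PowerSeries.X)) l *
        QLoop.divPow q (QLoop.dilate (q ^ (-2 * (l : ℤ))) (QLoop.EPlus q)) l)) =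
      if l ≤ n then ((-1 : ℂ) ^ l * q ^ (l ^ 2)) •
        ((((QLoop.K q) ^ (-(l : ℤ)) : (QLoop.U q)ˣ) : QLoop.U q) *
          ((q ^ (2 * l)) ^ (n - l) • PowerSeries.coeff (n - l) (QLoop.normalOrd q 1 l l)))
      else 0 := by
    intro l
    rw [QLoop.coeff_complex_smul, mul_assoc, mul_assoc, mul_assoc, ← mul_assoc (QLoop.dilate _ _),
      ← QLoop.scaleX_normalOrd_self hq0 hq, PowerSeries.coeff_C_mul, PowerSeries.coeff_X_pow_mul']
    split_ifs
    · rw [QLoop.coeff_scaleX]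
    · simp
  simp only [hterm, PowerSeries.coeff_mk]
  -- The factor X^l leaves only l ≤ n on the right; reflecting the sum over t matches l = n - t.
  rw [QLoop.divPow_E_mul_divPow_F hq0 hq n n le_rfl, Finset.sum_mul, Finset.smul_sum,
    ← Finset.sum_range_reflect]
  have hsum := hasSum_sum_of_ne_finset_zero (L := .unconditional ℕ) (s := Finset.range (n + 1))
    (f := fun l => if l ≤ n then ((-1 : ℂ) ^ l * q ^ (l ^ 2)) •
        ((((QLoop.K q) ^ (-(l : ℤ)) : (QLoop.U q)ˣ) : QLoop.U q) *
          ((q ^ (2 * l)) ^ (n - l) • PowerSeries.coeff (n - l) (QLoop.normalOrd q 1 l l)))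
      else 0) (fun l hl => if_neg (by simpa [Nat.lt_succ_iff] using hl))
  convert hsum using 1
  refine Finset.sum_congr rfl fun l hl => ?_
  have hln : l ≤ n := Nat.lt_succ_iff.1 (Finset.mem_range.1 hl)
  obtain ⟨t, rfl⟩ : ∃ t, n = l + t := ⟨n - l, by omega⟩
  have e1 : l + t + 1 - 1 - l = t := by omega
  have e2 : l + t - t = l := by omega
  have e3 : l + t - l = t := by omega
  rw [if_pos hln, e1, e2, e3]
  have hK : ((QLoop.K q : QLoop.U q)) ^ t *
      (((QLoop.K q) ^ (-((l + t : ℕ) : ℤ)) : (QLoop.U q)ˣ) : QLoop.U q) =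
      (((QLoop.K q) ^ (-(l : ℤ)) : (QLoop.U q)ˣ) : QLoop.U q) := by
    rw [← Units.val_pow_eq_pow_val, ← Units.val_mul, ← zpow_natCast, ← zpow_add]
    congr 2
    push_cast
    ring
  have hcomm := (QLoop.commute_K_coeff_normalOrd_self hq0 1 l t).units_zpow_left (-(l : ℤ))
  rw [smul_mul_assoc, mul_assoc, hK, ← hcomm.eq, mul_smul_comm, smul_smul, smul_smul]
  congr 1
  have hs : ((-1 : ℂ)) ^ t * (-1) ^ t = 1 := by rw [← mul_pow]; simp
  have hz : q ^ ((((l + t : ℕ) : ℤ) - ((l + t : ℕ) : ℤ)) * t - (t : ℤ) ^ 2) = (q ^ (t ^ 2))⁻¹ := by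
    rw [← zpow_natCast, ← zpow_neg]; congr 1; push_cast; ring
  -- The cross term 2lt is the rescaling by q²ˡ in degree t, and t² cancels against `orderCoeff` on
  -- the diagonal.
  have hz2 : q ^ ((l + t) ^ 2) = q ^ (l ^ 2) * (q ^ (2 * l)) ^ t * q ^ (t ^ 2) := by
    rw [← pow_mul, ← pow_add, ← pow_add]; congr 1; ring
  rw [QLoop.orderCoeff, hz, hz2, pow_add]
  field_simp
  linear_combination hs
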